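/- For every constant $K>0$ there is a constant $C>0$, depending only on $K$, such that every finite set $A\subset\mathbb R$ with $$|A(A+A+A+A)|\le K|A|^2$$ satisfies $$|A+A|\le C|A|^{3/2}.$$ Here $A+A=\{a+b : a,b\in A\}$ and $A(A+A+A+A)=\{a(b+c+d+e) : a,b,c,d,e\in A\}$. -/

import Mathlib

open scoped Pointwise

/-! Put `S = A + A` and `Y = A * (S + S)`. Each line `y = a * (b + x)` with `a ∈ A`, `b ∈ S` meets
`S × Y` above every `x ∈ S`. Since lines of positive slope are increasing, counting gaps replaces
Szemerédi–Trotter: on each line at least half of the steps between neighbouring columns climb few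
places in `Y`, and such a step determines its line. Hence `|A| |S|² ≪ |Y|² ≤ K² |A|⁴`, so `|S|² ≪ K²
|A|³`. -/

/-- A family of strictly increasing sequences of length `m + 1` with values below `n`, each
determined by any two consecutive terms, satisfies `#T * m ≤ 4 * n ^ 2`: at least half of the
gaps of each sequence are at most `2 * n / m`. -/
theorem card_mul_le_of_increasing_sequences {ι : Type*} (T : Finset ι) (g : ι → ℕ → ℕ) (m n : ℕ)
    (hlt : ∀ t ∈ T, ∀ i ≤ m, g t i < n)
    (hmono : ∀ t ∈ T, ∀ i < m, g t i < g t (i + 1))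
    (hinj : ∀ i < m, ∀ s ∈ T, ∀ t ∈ T, g s i = g t i → g s (i + 1) = g t (i + 1) → s = t) :
    T.card * m ≤ 4 * n ^ 2 := by
  classical
  rcases Nat.eq_zero_or_pos m with rfl | hm
  · simp
  set D := 2 * n / m with hD
  have hD1 : 2 * n < m * (D + 1) := Nat.lt_mul_div_succ _ hm
  have hD2 : m * D ≤ 2 * n := Nat.mul_div_le _ _
  -- The value at `i` and a gap in `1, …, D` determine the sequence.
  have few : ∀ i ∈ Finset.range m,
      (T.filter fun t => g t (i + 1) ≤ g t i + D).card ≤ n * D := by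
    intro i hi
    rw [Finset.mem_range] at hi
    have := Finset.card_le_card_of_injOn (s := T.filter fun t => g t (i + 1) ≤ g t i + D)
      (t := Finset.range n ×ˢ Finset.range D) (fun t => (g t i, g t (i + 1) - g t i - 1))
      (by
        intro t ht
        simp only [Finset.coe_filter, Set.mem_ofPred_eq] at ht
        have h1 := hlt t ht.1 i hi.le
        have h2 := hmono t ht.1 i hi
        simp only [Finset.coe_product, Set.mem_prod, Finset.coe_range, Set.mem_Iio]
        omega)
      (by
        intro s hs t ht hst
        simp only [Finset.coe_filter, Set.mem_ofPred_eq] at hs ht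
        simp only [Prod.mk.injEq] at hst
        have h1 := hmono s hs.1 i hi
        have h2 := hmono t ht.1 i hi
        exact hinj i hi s hs.1 t ht.1 hst.1 (by omega))
    simpa using this
  have many : ∀ t ∈ T,
      m ≤ 2 * ((Finset.range m).filter fun i => g t (i + 1) ≤ g t i + D).card := by
    intro t ht
    have tel : ∀ j ≤ m, g t 0 + ∑ i ∈ Finset.range j, (g t (i + 1) - g t i) = g t j := by
      intro j
      induction j with
      | zero => simp
      | succ j ih =>
        intro hj
        have := hmono t ht j (by omega)
        rw [Finset.sum_range_succ, ← add_assoc, ih (by omega)]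
        omega
    have hbad : ((Finset.range m).filter fun i => ¬ g t (i + 1) ≤ g t i + D).card * (D + 1)
        ≤ n := by
      calc _ ≤ ∑ i ∈ (Finset.range m).filter fun i => ¬ g t (i + 1) ≤ g t i + D,
            (g t (i + 1) - g t i) := by
            rw [← smul_eq_mul]
            refine Finset.card_nsmul_le_sum _ _ _ fun i hi => ?_
            have := (Finset.mem_filter.1 hi).2
            omega
        _ ≤ ∑ i ∈ Finset.range m, (g t (i + 1) - g t i) :=
            Finset.sum_le_sum_of_subset (Finset.filter_subset _ _)
        _ ≤ n := by
            have h1 := tel m le_rfl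
            have h2 := hlt t ht m le_rfl
            omega
    have hsplit := Finset.card_filter_add_card_filter_not (s := Finset.range m)
      (fun i => g t (i + 1) ≤ g t i + D)
    rw [Finset.card_range] at hsplit
    set b := ((Finset.range m).filter fun i => ¬ g t (i + 1) ≤ g t i + D).card
    have : 2 * b < m := by
      by_contra! h
      have := Nat.mul_le_mul_right (D + 1) h
      nlinarith
    omega
  have hdouble := Finset.sum_card_bipartiteAbove_eq_sum_card_bipartiteBelow
    (s := T) (t := Finset.range m) (fun t i => g t (i + 1) ≤ g t i + D)
  have h1 := Finset.sum_le_sum many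
  have h2 := Finset.sum_le_sum few
  simp only [Finset.bipartiteAbove, Finset.bipartiteBelow] at hdouble
  rw [← Finset.mul_sum, hdouble] at h1
  simp only [Finset.sum_const, smul_eq_mul, Finset.card_range] at h1 h2
  calc T.card * m ≤ 2 * (m * (n * D)) := h1.trans (Nat.mul_le_mul_left 2 h2)
    _ = 2 * n * (m * D) := by ring
    _ ≤ 2 * n * (2 * n) := Nat.mul_le_mul_left _ hD2
    _ = 4 * n ^ 2 := by ring

/-- If `a * (b + x) ∈ Y` for all `a ∈ P` and `b, x ∈ S`, where `P` consists of positive numbers,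
then the lines `y = a * (b + x)` are so rich in points of `S × Y` that `Y` is large. -/
theorem card_mul_card_mul_le_of_pos (P S Y : Finset ℝ) (hP : ∀ a ∈ P, 0 < a)
    (hY : ∀ a ∈ P, ∀ b ∈ S, ∀ x ∈ S, a * (b + x) ∈ Y) :
    P.card * S.card * (S.card - 1) ≤ 4 * Y.card ^ 2 := by
  classical
  rcases Nat.eq_zero_or_pos S.card with h0 | hpos
  · simp [h0]
  let x : ℕ → ℝ := fun i => if h : i < S.card then S.orderEmbOfFin rfl ⟨i, h⟩ else 0
  have hxS : ∀ i ≤ S.card - 1, x i ∈ S := by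
    intro i hi
    have h : i < S.card := by omega
    simp [x, h]
  have hx : ∀ i < S.card - 1, x i < x (i + 1) := by
    intro i hi
    have h : i < S.card := by omega
    have h' : i + 1 < S.card := by omega
    simp [x, h, h']
  -- The rank in `Y` turns heights into naturals below `Y.card`.
  let r : ℝ → ℕ := fun y => (Y.filter (· < y)).card
  have hr : ∀ y ∈ Y, ∀ z, y < z → r y < r z := by
    intro y hy z hyz
    refine Finset.card_lt_card (Finset.ssubset_iff_of_subset ?_ |>.2 ⟨y, ?_, ?_⟩)
    · intro w hw
      rw [Finset.mem_filter] at hw ⊢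
      exact ⟨hw.1, hw.2.trans hyz⟩
    · simp [hy, hyz]
    · simp
  have hrinj : ∀ y ∈ Y, ∀ z ∈ Y, r y = r z → y = z := by
    intro y hy z hz h
    rcases lt_trichotomy y z with h' | h' | h'
    · exact absurd h (hr y hy z h').ne
    · exact h'
    · exact absurd h (hr z hz y h').ne'
  have key := card_mul_le_of_increasing_sequences (P ×ˢ S)
    (fun t i => r (t.1 * (t.2 + x i))) (S.card - 1) Y.card
    (by
      rintro ⟨a, b⟩ ht i hi
      rw [Finset.mem_product] at ht
      have hmem := hY a ht.1 b ht.2 _ (hxS i hi)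
      refine Finset.card_lt_card (Finset.filter_ssubset.2 ⟨_, hmem, ?_⟩)
      simp)
    (by
      rintro ⟨a, b⟩ ht i hi
      rw [Finset.mem_product] at ht
      refine hr _ (hY a ht.1 b ht.2 _ (hxS i hi.le)) _ ?_
      have := hx i hi
      exact mul_lt_mul_of_pos_left (by linarith) (hP a ht.1))
    (by
      rintro i hi ⟨a, b⟩ hs ⟨a', b'⟩ ht h1 h2
      rw [Finset.mem_product] at hs ht
      have e1 := hrinj _ (hY a hs.1 b hs.2 _ (hxS i hi.le)) _
        (hY a' ht.1 b' ht.2 _ (hxS i hi.le)) h1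
      have e2 := hrinj _ (hY a hs.1 b hs.2 _ (hxS (i + 1) (by omega))) _
        (hY a' ht.1 b' ht.2 _ (hxS (i + 1) (by omega))) h2
      have hlt := hx i hi
      have ha : a = a' := by
        have : (a - a') * (x (i + 1) - x i) = 0 := by linear_combination e2 - e1
        rcases mul_eq_zero.1 this with h | h
        · linarith
        · linarith
      subst ha
      have := mul_left_cancel₀ (hP a hs.1).ne' e1
      have hb : b = b' := by linarith
      rw [hb])
  rwa [Finset.card_product] at key

/-- Split `A` by sign and reflect the negative part together with `Y`. Discarding `0` costs the `-
1`; adding the two bounds doubles the constant. -/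
theorem card_mul_card_mul_le (A S Y : Finset ℝ)
    (hY : ∀ a ∈ A, ∀ b ∈ S, ∀ x ∈ S, a * (b + x) ∈ Y) :
    (A.card - 1) * S.card * (S.card - 1) ≤ 8 * Y.card ^ 2 := by
  classical
  have hp := card_mul_card_mul_le_of_pos (A.filter (0 < ·)) S Y (by simp)
    (fun a ha => hY a (Finset.mem_filter.1 ha).1)
  have hn := card_mul_card_mul_le_of_pos ((A.filter (· < 0)).image (- ·)) S (Y.image (- ·))
    (by
      intro a ha
      obtain ⟨c, hc, rfl⟩ := Finset.mem_image.1 ha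
      exact neg_pos.2 (Finset.mem_filter.1 hc).2)
    (by
      intro a ha b hb x hx
      obtain ⟨c, hc, rfl⟩ := Finset.mem_image.1 ha
      exact Finset.mem_image.2 ⟨_, hY c (Finset.mem_filter.1 hc).1 b hb x hx, by ring⟩)
  rw [Finset.card_image_of_injective _ neg_injective,
    Finset.card_image_of_injective _ neg_injective] at hn
  have hA : A.card ≤ (A.filter (0 < ·)).card + (A.filter (· < 0)).card + 1 := by
    have hsub : A ⊆ (A.filter (0 < ·) ∪ A.filter (· < 0)) ∪ {0} := by
      intro a ha
      rcases lt_trichotomy a 0 with h | h | h <;> simp [ha, h]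
    refine (Finset.card_le_card hsub).trans ((Finset.card_union_le _ _).trans ?_)
    simpa using Finset.card_union_le (A.filter (0 < ·)) (A.filter (· < 0))
  calc (A.card - 1) * S.card * (S.card - 1)
      ≤ ((A.filter (0 < ·)).card + (A.filter (· < 0)).card) * S.card * (S.card - 1) := by
        gcongr
        omega
    _ ≤ 8 * Y.card ^ 2 := by linarith

theorem mainTheorem6 :
    ∀ K : ℝ, 0 < K → ∃ C : ℝ, 0 < C ∧ ∀ A : Finset ℝ,
      ((A * (A + A + A + A)).card : ℝ) ≤ K * (A.card : ℝ) ^ 2 →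
        ((A + A).card : ℝ) ≤ C * (A.card : ℝ) ^ (3 / 2 : ℝ) := by
  intro K hK
  -- `6 ^ 2 ≥ 32` serves the main case; the `+ 1` serves `A.card ≤ 1`.
  refine ⟨6 * K + 1, by positivity, fun A hA => ?_⟩
  have hpow : ((A.card : ℝ) ^ (3 / 2 : ℝ)) ^ 2 = (A.card : ℝ) ^ 3 := by
    rw [← Real.rpow_natCast, ← Real.rpow_mul (by positivity), ← Real.rpow_natCast]
    norm_num
  refine le_of_sq_le_sq ?_ (by positivity)
  rw [mul_pow, hpow]
  have hSle : (A + A).card ≤ A.card * A.card := Finset.card_add_le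
  rcases Nat.lt_or_ge A.card 2 with h | h
  · have h1 : ((A + A).card : ℝ) ≤ A.card := by
      have : (A + A).card ≤ A.card := by nlinarith
      exact_mod_cast this
    have h2 : (A.card : ℝ) = 0 ∨ (A.card : ℝ) = 1 := by
      have : A.card = 0 ∨ A.card = 1 := by omega
      exact_mod_cast this
    have h3 : (0 : ℝ) ≤ (A + A).card := by positivity
    rcases h2 with h2 | h2 <;> rw [h2] at h1 ⊢ <;> nlinarith
  have hAS : A.card ≤ (A + A).card := by
    have hne : A.Nonempty := Finset.card_pos.1 (by omega)
    exact Finset.card_le_card_add_right hne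
  have key := card_mul_card_mul_le A (A + A) (A * (A + A + A + A)) (by
    intro a ha b hb x hx
    rw [add_assoc (A + A) A A]
    exact Finset.mul_mem_mul ha (Finset.add_mem_add hb hx))
  set n := A.card
  set s := (A + A).card
  set y := (A * (A + A + A + A)).card
  have h1 : n * s ^ 2 ≤ 32 * y ^ 2 := by
    have e1 : n ≤ 2 * (n - 1) := by omega
    have e2 : s ≤ 2 * (s - 1) := by omega
    calc n * s ^ 2 = n * s * s := by ring
      _ ≤ (2 * (n - 1)) * s * (2 * (s - 1)) := by gcongr
      _ = 4 * ((n - 1) * s * (s - 1)) := by ring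
      _ ≤ 4 * (8 * y ^ 2) := Nat.mul_le_mul_left 4 key
      _ = 32 * y ^ 2 := by ring
  have h2 : (n : ℝ) * (s : ℝ) ^ 2 ≤ 32 * (y : ℝ) ^ 2 := by exact_mod_cast h1
  have h3 : (y : ℝ) ^ 2 ≤ (K * (n : ℝ) ^ 2) ^ 2 := by gcongr
  have hn : (0 : ℝ) < n := by
    have : 0 < n := by omega
    exact_mod_cast this
  have h4 : (s : ℝ) ^ 2 ≤ 32 * K ^ 2 * (n : ℝ) ^ 3 := by
    refine le_of_mul_le_mul_left ?_ hn
    calc (n : ℝ) * (s : ℝ) ^ 2 ≤ 32 * (K * (n : ℝ) ^ 2) ^ 2 := by linarith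
      _ = n * (32 * K ^ 2 * (n : ℝ) ^ 3) := by ring
  refine h4.trans (mul_le_mul_of_nonneg_right ?_ (by positivity))
  nlinarith
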